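/- Let $d\in\mathbb N$ and let $\phi$ be a continuous probability density (with respect to Lebesgue measure) on the space $M_{d\times d}(\mathbb R)$ of real $d\times d$ matrices such that, for some $C>0$, $\phi(A)\le C/\|A\|^{d^2+1}$ for all $A\neq 0$, where $\|\cdot\|$ is the operator norm. Then there is a constant $C_\phi>0$, depending only on $\phi$ (and $d$), with the following property. Let $M\ge 1$, $0<\epsilon\le 1$, let $A$ be any $d\times d$ matrix with $\|A\|\le M$, let $E$ be a random matrix with density $\phi$, and let $\mu_\epsilon$ be the law of $A+\epsilon E$. Then, for every $1\le k<d$, $\mu_\epsilon$ is carried by the invertible matrices and, acting on the bundle of miniflags $\operatorname{PF}(k-1,k,k+1)\to\operatorname{PF}(k-1,k+1)$, it has uniform fiberwise push-forward entropy at least $C_\phi\,\epsilon^2/M^2$; that is, $$\inf_{F\in \operatorname{PF}(k-1,k+1)} h_{\mathrm{FA}}(F,\mu_\epsilon)\ \ge\ \frac{C_\phi\,\epsilon^2}{M^2}.$$ Here $\operatorname{PF}(k-1,k+1)$ is the space of pairs $F=(V_{k-1}\subset V_{k+1})$ of linear subspaces of $\mathbb R^d$ with $\dim V_i=i$, and the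 fiber (miniflag) $\mathcal F(F)$ over $F$ is the set of all $k$-dimensional $V_k$ with $V_{k-1}\subset V_k\subset V_{k+1}$; an invertible matrix $B$ maps $\mathcal F(F)$ onto $\mathcal F(BF)$ by $V_k\mapsto BV_k$. For a probability measure $\mu$ on matrices that is carried by the invertible ones, let $\bar\mu_F$ be the law of $BF$ when $B$ has law $\mu$, and let $\mu_{F,F'}$ be the conditional law of $B$ given $BF=F'$. Then $$h_{\mathrm{FA}}(F,\mu)=\int h(\mu_{F,F'})\,d\bar\mu_F(F'),\qquad h(\mu_{F,F'})=\inf_\nu\int d_{\mathrm{KL}}\big(B_*\nu\,\big|\,\mu_{F,F'}*\nu\big)\,d\mu_{F,F'}(B),$$ where the infimum is over all Borel probability measures $\nu$ on $\mathcal F(F)$, $\mu_{F,F'}*\nu=\int B_*\nu\,d\mu_{F,F'}(B)$, and $d_{\mathrm{KL}}(\nu_1|\nu_2)=\int\log\frac{d\nu_1}{d\nu_2}\,d\nu_1$ if $\nu_1\ll\nu_2$ and $+\infty$ otherwise. -/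

import Mathlib

open MeasureTheory ProbabilityTheory
open scoped ENNReal

noncomputable section

/-! ### Entropy of random families of maps -/

section Entropy

variable {Ω X Y : Type*} [MeasurableSpace Ω] [MeasurableSpace X] [MeasurableSpace Y]

/-- The mean push-forward `μ * ν = ∫ (f_ω)_* ν dμ(ω)` of a measure `ν` on `X` under a random map
`f_ω : X → Y`, where `ω` has law `μ`. -/
def meanPushforward (μ : Measure Ω) (f : Ω → X → Y) (ν : Measure X) : Measure Y :=
  μ.bind fun ω => ν.map (f ω)

/-- The Furstenberg entropy `Φ_μ(ν) = ∫ d_KL((f_ω)_* ν | μ * ν) dμ(ω)`. -/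
def furstenbergEntropy (μ : Measure Ω) (f : Ω → X → Y) (ν : Measure X) : ℝ≥0∞ :=
  ∫⁻ ω, InformationTheory.klDiv (ν.map (f ω)) (meanPushforward μ f ν) ∂μ

/-- The push-forward entropy `h(μ)`: the infimum of `Φ_μ(ν)` over all probability measures `ν`
on the source space `X`. -/
def pushforwardEntropy (μ : Measure Ω) (f : Ω → X → Y) : ℝ≥0∞ :=
  ⨅ ν : ProbabilityMeasure X, furstenbergEntropy μ f (ν : Measure X)

end Entropy

/-! ### Matrices -/

/-- The space of real `d × d` matrices. -/
abbrev Mat (d : ℕ) : Type := Matrix (Fin d) (Fin d) ℝ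

instance (d : ℕ) : MeasurableSpace (Mat d) :=
  inferInstanceAs (MeasurableSpace (Fin d → Fin d → ℝ))

instance (d : ℕ) : BorelSpace (Mat d) :=
  inferInstanceAs (BorelSpace (Fin d → Fin d → ℝ))

instance (d : ℕ) : StandardBorelSpace (Mat d) :=
  inferInstanceAs (StandardBorelSpace (Fin d → Fin d → ℝ))

/-- Lebesgue measure on the space of matrices, with the entries as coordinates. -/
def matLebesgue (d : ℕ) : Measure (Mat d) :=
  (volume : Measure (Fin d → Fin d → ℝ)).map Matrix.of

/-- The operator norm of a matrix acting on Euclidean space. -/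
def opNorm {d : ℕ} (A : Mat d) : ℝ := ‖Matrix.toEuclideanCLM (n := Fin d) (𝕜 := ℝ) A‖

/-! ### Subspaces, partial flags and miniflags -/

/-- The set of all linear subspaces of `ℝ^d`, that is, the disjoint union of the Grassmannians
`Gr(k, d)` for `0 ≤ k ≤ d`. -/
abbrev Subsp (d : ℕ) : Type := Submodule ℝ (EuclideanSpace ℝ (Fin d))

/-- The usual topology of the Grassmannians: the subspace `V` is identified with the orthogonal
projection onto `V`. -/
instance (d : ℕ) : TopologicalSpace (Subsp d) :=
  TopologicalSpace.induced
    (fun V => (V.starProjection : EuclideanSpace ℝ (Fin d) →L[ℝ] EuclideanSpace ℝ (Fin d)))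
    inferInstance

instance (d : ℕ) : MeasurableSpace (Subsp d) := borel (Subsp d)

instance (d : ℕ) : BorelSpace (Subsp d) := ⟨rfl⟩

/-- The action of a matrix on subspaces, `V ↦ B V`. If `B` is invertible it preserves dimensions
and inclusions. -/
def actSubsp {d : ℕ} (B : Mat d) (V : Subsp d) : Subsp d :=
  V.map (Matrix.toEuclideanLin B)

/-- The space `PF(k-1, k+1)` of partial flags `V_{k-1} ⊆ V_{k+1} ⊆ ℝ^d` with
`dim V_{k-1} = k - 1` and `dim V_{k+1} = k + 1`. -/
def PF (d k : ℕ) : Set (Subsp d × Subsp d) :=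
  {F | F.1 ≤ F.2 ∧ Module.finrank ℝ F.1 + 1 = k ∧ Module.finrank ℝ F.2 = k + 1}

/-- The miniflag over the pair `F = (V_{k-1}, V_{k+1})`: all `k`-dimensional `V` with
`V_{k-1} ⊆ V ⊆ V_{k+1}`. It is the fibre over `F` of `PF(k-1, k, k+1) → PF(k-1, k+1)`. -/
def miniflag {d : ℕ} (k : ℕ) (F : Subsp d × Subsp d) : Set (Subsp d) :=
  {V | F.1 ≤ V ∧ V ≤ F.2 ∧ Module.finrank ℝ V = k}

/-- The action of a matrix on pairs of subspaces. An invertible matrix maps `PF(k-1, k+1)` to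
itself and the miniflag over `F` onto the miniflag over the image of `F`. -/
def actPair {d : ℕ} (F : Subsp d × Subsp d) (B : Mat d) : Subsp d × Subsp d :=
  (actSubsp B F.1, actSubsp B F.2)

/-- The map induced by a matrix on the miniflag over `F`. The target is taken to be the space of
all subspaces; for invertible `B` the image is the miniflag over `actPair F B`. -/
def actMiniflag {d : ℕ} (k : ℕ) (F : Subsp d × Subsp d) (B : Mat d) (V : miniflag k F) : Subsp d :=
  actSubsp B V

/-! ### Fibrewise entropy -/

/-- The conditional law `μ_{F, F'}` of a random matrix `B` with law `μ`, given that `B` carries the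
partial flag `F` to `F'`, as a Markov kernel in `F'` (regular conditional distribution; it is
determined up to a null set of the law of the image of `F`). -/
def condLaw {d : ℕ} (μ : Measure (Mat d)) [IsFiniteMeasure μ] (F : Subsp d × Subsp d) :
    Kernel (Subsp d × Subsp d) (Mat d) :=
  condDistrib (fun B : Mat d => B) (actPair F) μ

/-- The fibre-averaged push-forward entropy `h_FA(F, μ) = ∫ h(μ_{F, F'}) dμ̄_F(F')` of the
miniflag over `F`, where `μ̄_F` is the law of the image of `F`. -/
def fiberAveragedEntropy {d : ℕ} (k : ℕ) (μ : Measure (Mat d)) [IsFiniteMeasure μ]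
    (F : Subsp d × Subsp d) : ℝ≥0∞ :=
  ∫⁻ F', pushforwardEntropy (condLaw μ F F') (actMiniflag k F) ∂(μ.map (actPair F))

/-- The uniform fibrewise push-forward entropy of `μ` acting on the bundle
`PF(k-1, k, k+1) → PF(k-1, k+1)`: the infimum of `h_FA(F, μ)` over all miniflags. -/
def uniformFiberwiseEntropy {d : ℕ} (k : ℕ) (μ : Measure (Mat d)) [IsFiniteMeasure μ] : ℝ≥0∞ :=
  ⨅ F ∈ PF d k, fiberAveragedEntropy k μ F

end

/-!
Pinsker's inequality turns small entropy into almost invariance: if a substitution `ω ↦ θ ω` of the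
random parameter distorts its law by a bounded factor on an event of positive probability and turns
the random map `f_ω` into `f_ω ∘ γ`, then every measure `ν` with Furstenberg entropy `Φ` satisfies
`|ν(T) - ν(γ⁻¹ T)| = O(√Φ)` for all measurable `T`. If the `n`-th iterates of two such maps `γ` play
ping-pong, no probability measure is invariant under both of these iterates up to a small error, so
`n √Φ` is bounded below and the entropy is at least of order `1 / n²`.

For random matrices one takes `B ↦ B * g` with `g F = F`: this preserves the fibers of `B ↦ B F`, so
the bounded distortion of the law of `B` passes to the conditional laws. The miniflag over `F` is a
projective line, and the maps `g` are the two opposite transvections with parameter `1 / n` in the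
plane underlying it, whose `n`-th powers `x ↦ x + 1` and `x ↦ x / (x + 1)` play ping-pong. Right
multiplication by `g` moves `A + ε E` by `O((M + ε) / n)`, which noise of size `ε` absorbs as soon
as `n` is of order `M / ε`.
-/

noncomputable section

open scoped NNReal

section KullbackLeibler

open InformationTheory

variable {Ω X Y : Type*} [MeasurableSpace Ω] [MeasurableSpace X] [MeasurableSpace Y]

-- Young's inequality: `s ↦ exp s - 1` is the convex conjugate of `klFun`.
theorem mul_sub_exp_le_klFun {r : ℝ} (hr : 0 ≤ r) (s : ℝ) :
    s * r - (Real.exp s - 1) ≤ klFun r := by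
  rcases hr.eq_or_lt with rfl | hr
  · simp only [klFun, mul_zero, Real.log_zero, zero_add, sub_zero, zero_sub]
    linarith [Real.exp_pos s]
  · have h := Real.add_one_le_exp (s - Real.log r)
    rw [Real.exp_sub, Real.exp_log hr, le_div_iff₀ hr] at h
    unfold klFun
    linarith

theorem mul_measureReal_sub_le_toReal_klDiv (p m : Measure X) [IsFiniteMeasure p]
    [IsFiniteMeasure m] (hpm : klDiv p m ≠ ∞) (S : Set X) (s : ℝ) :
    s * p.real S - m.real S * (Real.exp s - 1) ≤ (klDiv p m).toReal := by
  obtain ⟨hac, hint⟩ := klDiv_ne_top_iff.1 hpm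
  have hkl : Integrable (fun x => klFun (p.rnDeriv m x).toReal) m :=
    (integrable_klFun_rnDeriv_iff hac).2 hint
  have hrn : Integrable (fun x => s * (p.rnDeriv m x).toReal) m :=
    Measure.integrable_toReal_rnDeriv.const_mul s
  calc s * p.real S - m.real S * (Real.exp s - 1)
      = ∫ x in S, (s * (p.rnDeriv m x).toReal - (Real.exp s - 1)) ∂m := by
        rw [integral_sub hrn.integrableOn (integrable_const _), integral_const_mul,
          Measure.setIntegral_toReal_rnDeriv hac, setIntegral_const, smul_eq_mul]
    _ ≤ ∫ x in S, klFun (p.rnDeriv m x).toReal ∂m :=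
        integral_mono (hrn.sub (integrable_const _)).integrableOn hkl.integrableOn fun x =>
          mul_sub_exp_le_klFun ENNReal.toReal_nonneg s
    _ ≤ ∫ x, klFun (p.rnDeriv m x).toReal ∂m :=
        setIntegral_le_integral hkl (.of_forall fun x => klFun_nonneg ENNReal.toReal_nonneg)
    _ = (klDiv p m).toReal := (toReal_klDiv_eq_integral_klFun hac).symm

theorem sq_measureReal_sub_le_klDiv (p m : Measure X) [IsProbabilityMeasure p]
    [IsProbabilityMeasure m] (S : Set X) :
    ENNReal.ofReal ((p.real S - m.real S) ^ 2 / 4) ≤ klDiv p m := by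
  by_cases htop : klDiv p m = ∞
  · exact htop ▸ le_top
  rw [ENNReal.ofReal_le_iff_le_toReal htop]
  set s : ℝ := (p.real S - m.real S) / 2
  have hs : |s| ≤ 1 := by
    have hp := measureReal_le_one (μ := p) (s := S)
    have hm := measureReal_le_one (μ := m) (s := S)
    have hp₀ := measureReal_nonneg (μ := p) (s := S)
    have hm₀ := measureReal_nonneg (μ := m) (s := S)
    simp only [s, abs_le]
    constructor <;> linarith
  have hexp : Real.exp s - 1 ≤ s + s ^ 2 := by
    linarith [(le_abs_self _).trans (Real.abs_exp_sub_one_sub_id_le hs)]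
  have hmS : m.real S * (Real.exp s - 1) ≤ m.real S * s + s ^ 2 := by
    nlinarith [mul_le_mul_of_nonneg_left hexp (measureReal_nonneg (μ := m) (s := S)),
      measureReal_le_one (μ := m) (s := S), sq_nonneg s]
  calc (p.real S - m.real S) ^ 2 / 4 = s * p.real S - (m.real S * s + s ^ 2) := by ring
    _ ≤ s * p.real S - m.real S * (Real.exp s - 1) := by gcongr
    _ ≤ (klDiv p m).toReal := mul_measureReal_sub_le_toReal_klDiv p m htop S s

theorem sq_measureReal_sub_le_klDiv_add_klDiv (p q m : Measure X) [IsProbabilityMeasure p]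
    [IsProbabilityMeasure q] [IsProbabilityMeasure m] (S : Set X) :
    ENNReal.ofReal ((p.real S - q.real S) ^ 2 / 8) ≤ klDiv p m + klDiv q m := by
  refine le_trans ?_ (add_le_add (sq_measureReal_sub_le_klDiv p m S)
    (sq_measureReal_sub_le_klDiv q m S))
  rw [← ENNReal.ofReal_add (by positivity) (by positivity)]
  apply ENNReal.ofReal_le_ofReal
  nlinarith [sq_nonneg (p.real S - m.real S + (q.real S - m.real S))]

theorem measurable_klDiv_kernel [MeasurableSpace.CountablyGenerated X] (κ η : Kernel Ω X)
    [IsFiniteKernel κ] [IsFiniteKernel η] : Measurable fun ω => klDiv (κ ω) (η ω) := by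
  classical
  have h : ∀ ω, klDiv (κ ω) (η ω) = if κ ω ≪ η ω then
      ∫⁻ x, ENNReal.ofReal (klFun (κ.rnDeriv η ω x).toReal) ∂(η ω) else ∞ := by
    intro ω
    split_ifs with hac
    · rw [klDiv_eq_lintegral_klFun_of_ac hac]
      refine lintegral_congr_ae ?_
      filter_upwards [Kernel.rnDeriv_eq_rnDeriv_measure (κ := κ) (η := η) (a := ω)] with x hx
      rw [hx]
    · exact klDiv_of_not_ac hac
  simp_rw [h]
  refine Measurable.ite (Kernel.measurableSet_absolutelyContinuous κ η) ?_ measurable_const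
  exact Measurable.lintegral_kernel_prod_right
    (f := fun ω x => ENNReal.ofReal (klFun (κ.rnDeriv η ω x).toReal))
    (measurable_klFun.comp (Kernel.measurable_rnDeriv κ η).ennreal_toReal).ennreal_ofReal

theorem map_eq_kernel_map {f : Ω → X → Y} (hf : Measurable (Function.uncurry f))
    (ν : Measure X) [SFinite ν] (ω : Ω) :
    ν.map (f ω) = (Kernel.id ×ₖ Kernel.const Ω ν).map (Function.uncurry f) ω := by
  rw [Kernel.map_apply _ hf, Kernel.prod_apply, Kernel.id_apply, Kernel.const_apply,
    Measure.dirac_prod, Measure.map_map hf measurable_prodMk_left]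
  rfl

theorem measurable_klDiv_map [MeasurableSpace.CountablyGenerated Y] {f : Ω → X → Y}
    (hf : Measurable (Function.uncurry f)) (ν : Measure X) [IsFiniteMeasure ν]
    (m : Measure Y) [IsFiniteMeasure m] : Measurable fun ω => klDiv (ν.map (f ω)) m := by
  simp_rw [map_eq_kernel_map hf]
  exact measurable_klDiv_kernel _ (Kernel.const Ω m)

theorem isProbabilityMeasure_meanPushforward (μ : Measure Ω) [IsProbabilityMeasure μ]
    {f : Ω → X → Y} (hf : Measurable (Function.uncurry f)) (ν : Measure X)
    [IsProbabilityMeasure ν] : IsProbabilityMeasure (meanPushforward μ f ν) := by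
  have := Kernel.IsMarkovKernel.map (Kernel.id ×ₖ Kernel.const Ω ν) hf
  simp_rw [meanPushforward, map_eq_kernel_map hf]
  infer_instance

end KullbackLeibler

section PingPong

variable {X : Type*} [MeasurableSpace X]

/-- The measure `ν` is invariant under `γ` up to an error of at most `δ` on each measurable set. -/
def IsAlmostInvariant (ν : Measure X) (γ : X → X) (δ : ℝ) : Prop :=
  ∀ ⦃T : Set X⦄, MeasurableSet T → |ν.real T - ν.real (γ ⁻¹' T)| ≤ δ

theorem IsAlmostInvariant.iterate {ν : Measure X} {γ : X → X} {δ : ℝ}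
    (h : IsAlmostInvariant ν γ δ) (hγ : Measurable γ) (n : ℕ) :
    IsAlmostInvariant ν γ^[n] (n * δ) := by
  intro T hT
  induction n with
  | zero => simp
  | succ n ih =>
    rw [Function.iterate_succ, Set.preimage_comp, Nat.cast_succ, add_one_mul]
    exact (abs_sub_le _ _ _).trans (add_le_add ih (h (hγ.iterate n hT)))

/-- A pair of maps playing ping-pong: the attracting sets `Q` of `γ₁` and `P \ Q` of `γ₂` are
disjoint and fill the table `P`, and no point off `P` stays off `P` under both maps. -/
structure IsPingPong (γ₁ γ₂ : X → X) (P Q : Set X) : Prop where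
  measurableSet_table : MeasurableSet P
  measurableSet_attracting : MeasurableSet Q
  attracting_subset : Q ⊆ P
  mapsTo_left : Set.MapsTo γ₁ P Q
  mapsTo_right : Set.MapsTo γ₂ P (P \ Q)
  left_mem_or_right_mem : ∀ x ∉ P, γ₁ x ∈ P ∨ γ₂ x ∈ P

theorem IsPingPong.one_le_of_isAlmostInvariant {γ₁ γ₂ : X → X} {P Q : Set X}
    (h : IsPingPong γ₁ γ₂ P Q) (hγ₂ : Measurable γ₂) {ν : Measure X} [IsProbabilityMeasure ν]
    {δ : ℝ} (h₁ : IsAlmostInvariant ν γ₁ δ) (h₂ : IsAlmostInvariant ν γ₂ δ) : 1 ≤ 4 * δ := by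
  have hP := h.measurableSet_table
  have hQ := h.measurableSet_attracting
  have hPQ : ν.real P = ν.real Q + ν.real (P \ Q) := by
    rw [measureReal_sdiff h.attracting_subset hQ]
    ring
  have hin : ν.real P ≤ 2 * δ := by
    have h1 : ν.real P ≤ ν.real (γ₁ ⁻¹' Q) := measureReal_mono h.mapsTo_left
    have h2 : ν.real P ≤ ν.real (γ₂ ⁻¹' (P \ Q)) := measureReal_mono h.mapsTo_right
    linarith [(abs_le.1 (h₁ hQ)).1, (abs_le.1 (h₂ (hP.diff hQ))).1]
  have hout : ν.real Pᶜ ≤ 2 * δ := by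
    have hdisj : Disjoint (γ₁ ⁻¹' Pᶜ) (γ₂ ⁻¹' Pᶜ) := by
      refine Set.disjoint_left.2 fun x hx₁ hx₂ => ?_
      have hx : x ∉ P := fun hx => hx₁ (h.attracting_subset (h.mapsTo_left hx))
      exact (h.left_mem_or_right_mem x hx).elim hx₁ hx₂
    have hsub : γ₁ ⁻¹' Pᶜ ∪ γ₂ ⁻¹' Pᶜ ⊆ Pᶜ := Set.union_subset
      (fun x hx hxP => hx (h.attracting_subset (h.mapsTo_left hxP)))
      (fun x hx hxP => hx (h.mapsTo_right hxP).1)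
    have hle := measureReal_mono (μ := ν) hsub
    rw [measureReal_union hdisj (hγ₂ hP.compl)] at hle
    linarith [(abs_le.1 (h₁ hP.compl)).2, (abs_le.1 (h₂ hP.compl)).2]
  linarith [probReal_add_probReal_compl (μ := ν) hP]

end PingPong

section EntropyBound

/-- The change of parameter `θ` turns the random map `f ω` into `f ω ∘ γ`. -/
structure RealizesPrecomp {Ω X Y : Type*} [MeasurableSpace Ω] [MeasurableSpace X]
    (f : Ω → X → Y) (θ : Ω → Ω) (γ : X → X) : Prop where
  measurable_param : Measurable θ
  measurable_map : Measurable γ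
  apply_param : ∀ ω, f (θ ω) = f ω ∘ γ

variable {Ω X Y : Type*} [MeasurableSpace Ω] [mX : MeasurableSpace X] [mY : MeasurableSpace Y]

theorem sq_measureReal_sub_preimage_le_klDiv_add_klDiv {f : X → Y} (hf : Measurable f)
    (hcomap : mX ≤ mY.comap f) {γ : X → X} (hγ : Measurable γ) (ν : Measure X)
    [IsProbabilityMeasure ν] (m : Measure Y) [IsProbabilityMeasure m] {T : Set X}
    (hT : MeasurableSet T) :
    ENNReal.ofReal ((ν.real T - ν.real (γ ⁻¹' T)) ^ 2 / 8) ≤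
      InformationTheory.klDiv (ν.map f) m + InformationTheory.klDiv (ν.map (f ∘ γ)) m := by
  obtain ⟨S, hS, rfl⟩ := hcomap T hT
  have := Measure.isProbabilityMeasure_map (μ := ν) hf.aemeasurable
  have := Measure.isProbabilityMeasure_map (μ := ν) (hf.comp hγ).aemeasurable
  have h := sq_measureReal_sub_le_klDiv_add_klDiv (ν.map f) (ν.map (f ∘ γ)) m S
  rwa [map_measureReal_apply hf hS, map_measureReal_apply (hf.comp hγ) hS,
    Set.preimage_comp] at h

variable [MeasurableSpace.CountablyGenerated Y] {μ : Measure Ω} [IsProbabilityMeasure μ]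
  {f : Ω → X → Y} {R : Set Ω} {K : ℝ≥0}

theorem sq_measureReal_sub_preimage_mul_le_furstenbergEntropy
    (hf : Measurable (Function.uncurry f)) (hcomap : ∀ᵐ ω ∂μ, mX ≤ mY.comap (f ω))
    {θ : Ω → Ω} {γ : X → X} (h : RealizesPrecomp f θ γ) (hK : (μ.restrict R).map θ ≤ K • μ)
    (ν : Measure X) [IsProbabilityMeasure ν] {T : Set X} (hT : MeasurableSet T) :
    ENNReal.ofReal ((ν.real T - ν.real (γ ⁻¹' T)) ^ 2 / 8) * μ R ≤
      (1 + K) * furstenbergEntropy μ f ν := by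
  set m := meanPushforward μ f ν
  have : IsProbabilityMeasure m := isProbabilityMeasure_meanPushforward μ hf ν
  set D : Ω → ℝ≥0∞ := fun ω => InformationTheory.klDiv (ν.map (f ω)) m
  have hD : Measurable D := measurable_klDiv_map hf ν m
  calc _ = ∫⁻ _ in R, ENNReal.ofReal ((ν.real T - ν.real (γ ⁻¹' T)) ^ 2 / 8) ∂μ := by
        rw [setLIntegral_const]
    _ ≤ ∫⁻ ω in R, (D ω + D (θ ω)) ∂μ := by
        refine lintegral_mono_ae ?_
        filter_upwards [ae_restrict_of_ae hcomap] with ω hω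
        simp only [D, h.apply_param]
        exact sq_measureReal_sub_preimage_le_klDiv_add_klDiv hf.of_uncurry_left hω
          h.measurable_map ν m hT
    _ = ∫⁻ ω in R, D ω ∂μ + ∫⁻ ω, D ω ∂((μ.restrict R).map θ) := by
        rw [lintegral_add_left hD, lintegral_map hD h.measurable_param]
    _ ≤ ∫⁻ ω, D ω ∂μ + ∫⁻ ω, D ω ∂(K • μ) :=
        add_le_add (setLIntegral_le_lintegral _ _) (lintegral_mono' hK le_rfl)
    _ = (1 + K) * furstenbergEntropy μ f ν := by
        rw [lintegral_smul_measure, add_mul, one_mul, ENNReal.smul_def, smul_eq_mul]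
        rfl

theorem isAlmostInvariant_of_furstenbergEntropy_ne_top
    (hf : Measurable (Function.uncurry f)) (hcomap : ∀ᵐ ω ∂μ, mX ≤ mY.comap (f ω))
    {θ : Ω → Ω} {γ : X → X} (h : RealizesPrecomp f θ γ)
    (hK : (μ.restrict R).map θ ≤ K • μ) (hR : μ R ≠ 0) {ν : Measure X}
    [IsProbabilityMeasure ν] (hν : furstenbergEntropy μ f ν ≠ ∞) :
    IsAlmostInvariant ν γ
      √(8 * (1 + K) * (furstenbergEntropy μ f ν).toReal / μ.real R) := by
  intro T hT
  have hRpos : 0 < μ.real R := ENNReal.toReal_pos hR (measure_ne_top _ _)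
  have hle := ENNReal.toReal_mono (ENNReal.mul_ne_top (by simp) hν)
    (sq_measureReal_sub_preimage_mul_le_furstenbergEntropy hf hcomap h hK ν hT)
  rw [ENNReal.toReal_mul, ENNReal.toReal_mul, ENNReal.toReal_ofReal (by positivity),
    ENNReal.toReal_add (by simp) (by simp), ENNReal.toReal_one, ENNReal.coe_toReal] at hle
  refine Real.abs_le_sqrt ((le_div_iff₀ hRpos).2 ?_)
  change _ / 8 * μ.real R ≤ _ at hle
  linarith

theorem measure_div_le_pushforwardEntropy_of_isPingPong
    (hf : Measurable (Function.uncurry f)) (hcomap : ∀ᵐ ω ∂μ, mX ≤ mY.comap (f ω))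
    {θ₁ θ₂ : Ω → Ω} {γ₁ γ₂ : X → X} (h₁ : RealizesPrecomp f θ₁ γ₁)
    (h₂ : RealizesPrecomp f θ₂ γ₂) (hK₁ : (μ.restrict R).map θ₁ ≤ K • μ)
    (hK₂ : (μ.restrict R).map θ₂ ≤ K • μ) {n : ℕ} {P Q : Set X}
    (hPQ : IsPingPong γ₁^[n] γ₂^[n] P Q) :
    μ R / (128 * (1 + K) * n ^ 2) ≤ pushforwardEntropy μ f := by
  refine le_iInf fun ν => ?_
  set Φ := furstenbergEntropy μ f (ν : Measure X)
  by_cases hΦ : Φ = ∞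
  · exact hΦ ▸ le_top
  refine ENNReal.div_le_of_le_mul' ?_
  by_cases hR : μ R = 0
  · exact hR ▸ zero_le
  have hRpos : 0 < μ.real R := ENNReal.toReal_pos hR (measure_ne_top _ _)
  have hν₁ := isAlmostInvariant_of_furstenbergEntropy_ne_top hf hcomap h₁ hK₁ hR hΦ
  have hν₂ := isAlmostInvariant_of_furstenbergEntropy_ne_top hf hcomap h₂ hK₂ hR hΦ
  have hδ := hPQ.one_le_of_isAlmostInvariant (h₂.measurable_map.iterate n)
    (hν₁.iterate h₁.measurable_map n) (hν₂.iterate h₂.measurable_map n)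
  have hsq : 1 ≤ 128 * (1 + K) * n ^ 2 * Φ.toReal / μ.real R := by
    calc (1 : ℝ) ≤ (4 * (n * √(8 * (1 + K) * Φ.toReal / μ.real R))) ^ 2 := one_le_pow₀ hδ
      _ = 128 * (1 + K) * n ^ 2 * Φ.toReal / μ.real R := by
        rw [mul_pow, mul_pow, Real.sq_sqrt (by positivity)]
        ring
  rw [one_le_div hRpos] at hsq
  rw [← ENNReal.toReal_le_toReal (measure_ne_top μ R) (by finiteness)]
  simpa [ENNReal.toReal_add, measureReal_def] using hsq

end EntropyBound

section ConditionalLaw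

variable {Ω β : Type*} [MeasurableSpace Ω] [MeasurableSpace β]

theorem exists_eq_withDensity_of_le_smul {ξ μ : Measure Ω} [SigmaFinite ξ] [SigmaFinite μ]
    {K : ℝ≥0} (h : ξ ≤ K • μ) :
    ∃ ρ : Ω → ℝ≥0∞, Measurable ρ ∧ (∀ ω, ρ ω ≤ K) ∧ ξ = μ.withDensity ρ := by
  have hac : ξ ≪ μ := (Measure.absolutelyContinuous_of_le h).trans
    (Measure.smul_absolutelyContinuous (c := (K : ℝ≥0∞)))
  have hle : ξ.rnDeriv μ ≤ᵐ[μ] fun _ => (K : ℝ≥0∞) := by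
    refine ae_le_of_forall_setLIntegral_le_of_sigmaFinite (Measure.measurable_rnDeriv ξ μ)
      fun s _ _ => ?_
    rw [Measure.setLIntegral_rnDeriv hac, setLIntegral_const]
    exact h s
  refine ⟨fun ω => min (ξ.rnDeriv μ ω) K, (Measure.measurable_rnDeriv ξ μ).min measurable_const,
    fun ω => min_le_right _ _, ?_⟩
  conv_lhs => rw [← Measure.withDensity_rnDeriv_eq ξ μ hac]
  exact withDensity_congr_ae (hle.mono fun ω hω => (min_eq_left hω).symm)

theorem ae_kernel_le_smul_of_compProd_le [MeasurableSpace.CountablyGenerated Ω] {ν : Measure β}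
    [IsFiniteMeasure ν] {κ η : Kernel β Ω} [IsFiniteKernel κ] [IsFiniteKernel η] {K : ℝ≥0}
    (h : ν ⊗ₘ κ ≤ K • (ν ⊗ₘ η)) : ∀ᵐ b ∂ν, κ b ≤ K • η b := by
  obtain ⟨ρ, hρ, hρK, hκ⟩ := exists_eq_withDensity_of_le_smul h
  have hρ' : Measurable (Function.uncurry fun b ω => ρ (b, ω)) := hρ
  have : IsFiniteKernel (η.withDensity fun b ω => ρ (b, ω)) :=
    Kernel.isFiniteKernel_withDensity_of_bounded η ENNReal.coe_ne_top fun b ω => hρK (b, ω)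
  have heq : ν ⊗ₘ κ = ν ⊗ₘ η.withDensity fun b ω => ρ (b, ω) := by
    rw [Measure.compProd_withDensity hρ', hκ]
  filter_upwards [Kernel.ae_eq_of_compProd_eq heq] with b hb
  rw [hb, Kernel.withDensity_apply _ hρ']
  exact (withDensity_mono (.of_forall fun ω => hρK (b, ω))).trans_eq (withDensity_const _)

theorem compProd_restrict_right (ν : Measure β) [SFinite ν] (κ : Kernel β Ω) [IsSFiniteKernel κ]
    {R : Set Ω} (hR : MeasurableSet R) :
    ν ⊗ₘ κ.restrict hR = (ν ⊗ₘ κ).restrict (Prod.snd ⁻¹' R) := by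
  rw [← Set.univ_prod, Measure.compProd, Measure.compProd,
    ← Kernel.restrict_apply _ (MeasurableSet.univ.prod hR), ← Kernel.compProd_restrict_right hR]
  rfl

variable [StandardBorelSpace Ω] [Nonempty Ω] {μ : Measure Ω} [IsFiniteMeasure μ] {X : Ω → β}

theorem map_compProd_condDistrib_id :
    μ.map X ⊗ₘ condDistrib (fun ω => ω) X μ = μ.map fun ω => (X ω, ω) :=
  compProd_map_condDistrib aemeasurable_id

theorem ae_condDistrib_map_restrict_le (hX : Measurable X) {θ : Ω → Ω} (hθ : Measurable θ)
    (hXθ : ∀ ω, X (θ ω) = X ω) {R : Set Ω} (hR : MeasurableSet R) {K : ℝ≥0}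
    (h : (μ.restrict R).map θ ≤ K • μ) :
    ∀ᵐ b ∂μ.map X, ((condDistrib (fun ω => ω) X μ b).restrict R).map θ ≤
      K • condDistrib (fun ω => ω) X μ b := by
  set κ := condDistrib (fun ω => ω) X μ
  have hgraph : Measurable fun ω => (X ω, ω) := hX.prodMk measurable_id
  have hκθ : μ.map X ⊗ₘ (κ.restrict hR).map θ =
      ((μ.restrict R).map θ).map fun ω => (X ω, ω) := by
    rw [Measure.compProd_map hθ, compProd_restrict_right, map_compProd_condDistrib_id,
      Measure.restrict_map hgraph (measurable_snd hR), Measure.map_map (by fun_prop) hgraph,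
      Measure.map_map hgraph hθ]
    simp only [Function.comp_def, Prod.map, id, hXθ, Set.preimage_preimage, Set.preimage_id']
  have hle : μ.map X ⊗ₘ (κ.restrict hR).map θ ≤ K • (μ.map X ⊗ₘ κ) := by
    rw [hκθ, map_compProd_condDistrib_id, ← Measure.map_smul]
    exact Measure.map_mono h hgraph
  filter_upwards [ae_kernel_le_smul_of_compProd_le hle] with b hb
  rwa [Kernel.map_apply _ hθ, Kernel.restrict_apply] at hb

theorem ae_ae_condDistrib (hX : Measurable X) {p : Ω → Prop} (hp : MeasurableSet {ω | p ω})
    (h : ∀ᵐ ω ∂μ, p ω) : ∀ᵐ b ∂μ.map X, ∀ᵐ ω ∂condDistrib (fun ω => ω) X μ b, p ω := by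
  refine Measure.ae_ae_of_ae_compProd (p := fun x => p x.2) ?_
  rw [map_compProd_condDistrib_id]
  exact (ae_map_iff (hX.prodMk measurable_id).aemeasurable (measurable_snd hp)).2 h

theorem lintegral_condDistrib_apply (hX : Measurable X) {R : Set Ω} (hR : MeasurableSet R) :
    ∫⁻ b, condDistrib (fun ω => ω) X μ b R ∂μ.map X = μ R := by
  have h := setLIntegral_preimage_condDistrib (μ := μ) hX (Y := fun ω => ω) aemeasurable_id
    hR MeasurableSet.univ
  rw [lintegral_map (Kernel.measurable_coe _ hR) hX]
  simpa using h

theorem measure_div_le_lintegral_pushforwardEntropy_condDistrib {Z Y : Type*}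
    [mZ : MeasurableSpace Z] [mY : MeasurableSpace Y] [MeasurableSpace.CountablyGenerated Y]
    {f : Ω → Z → Y} (hX : Measurable X) (hf : Measurable (Function.uncurry f)) {s : Set Ω}
    (hs : MeasurableSet s) (hμs : ∀ᵐ ω ∂μ, ω ∈ s)
    (hcomap : ∀ ω ∈ s, mZ ≤ mY.comap (f ω))
    {θ₁ θ₂ : Ω → Ω} {γ₁ γ₂ : Z → Z} (h₁ : RealizesPrecomp f θ₁ γ₁)
    (h₂ : RealizesPrecomp f θ₂ γ₂) (hXθ₁ : ∀ ω, X (θ₁ ω) = X ω)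
    (hXθ₂ : ∀ ω, X (θ₂ ω) = X ω) {R : Set Ω} (hR : MeasurableSet R) {K : ℝ≥0}
    (hK₁ : (μ.restrict R).map θ₁ ≤ K • μ) (hK₂ : (μ.restrict R).map θ₂ ≤ K • μ) {n : ℕ}
    {P Q : Set Z} (hPQ : IsPingPong γ₁^[n] γ₂^[n] P Q) :
    μ R / (128 * (1 + K) * n ^ 2) ≤
      ∫⁻ b, pushforwardEntropy (condDistrib (fun ω => ω) X μ b) f ∂μ.map X := by
  rw [← lintegral_condDistrib_apply hX hR, div_eq_mul_inv,
    ← lintegral_mul_const _ (Kernel.measurable_coe _ hR)]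
  refine lintegral_mono_ae ?_
  filter_upwards [ae_ae_condDistrib hX hs hμs,
    ae_condDistrib_map_restrict_le hX h₁.measurable_param hXθ₁ hR hK₁,
    ae_condDistrib_map_restrict_le hX h₂.measurable_param hXθ₂ hR hK₂] with b hb hb₁ hb₂
  rw [← div_eq_mul_inv]
  exact measure_div_le_pushforwardEntropy_of_isPingPong hf (hb.mono hcomap) h₁ h₂ hb₁
    hb₂ hPQ

end ConditionalLaw

section Grassmannian

theorem inner_starProjection_self {E : Type*} [NormedAddCommGroup E] [InnerProductSpace ℝ E]
    (V : Submodule ℝ E) [V.HasOrthogonalProjection] (x : E) :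
    inner ℝ x (V.starProjection x) = ‖x‖ ^ 2 - ‖x - V.starProjection x‖ ^ 2 := by
  have horth : inner ℝ (x - V.starProjection x) (V.starProjection x) = 0 :=
    V.starProjection_inner_eq_zero x _ (V.starProjection_apply_mem x)
  rw [inner_sub_left, real_inner_self_eq_norm_sq] at horth
  rw [norm_sub_sq_real]
  linarith

theorem inner_starProjection_eq_polarization {E : Type*} [NormedAddCommGroup E]
    [InnerProductSpace ℝ E] (V : Submodule ℝ E) [V.HasOrthogonalProjection] (x y : E) :
    inner ℝ x (V.starProjection y) = (inner ℝ (x + y) (V.starProjection (x + y)) -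
      inner ℝ (x - y) (V.starProjection (x - y))) / 4 := by
  have hsymm : inner ℝ y (V.starProjection x) = inner ℝ x (V.starProjection y) := by
    rw [real_inner_comm, V.inner_starProjection_left_eq_right]
  simp only [map_add, map_sub, inner_add_left, inner_sub_left, inner_add_right, inner_sub_right,
    hsymm]
  ring

variable {d : ℕ}

instance : SecondCountableTopology (Subsp d) :=
  Topology.IsInducing.secondCountableTopology (f := fun V : Subsp d => V.starProjection) ⟨rfl⟩

theorem continuous_toEuclideanCLM :
    Continuous fun A : Mat d => Matrix.toEuclideanCLM (n := Fin d) (𝕜 := ℝ) A :=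
  LinearMap.continuous_of_finiteDimensional
    (Matrix.toEuclideanCLM (n := Fin d) (𝕜 := ℝ)).toAlgEquiv.toLinearMap

theorem measurable_starProjection_apply (x : EuclideanSpace ℝ (Fin d)) :
    Measurable fun V : Subsp d => V.starProjection x := by
  have h : Continuous fun V : Subsp d => V.starProjection := continuous_induced_dom
  exact (h.clm_apply continuous_const).measurable

variable {α : Type*} [MeasurableSpace α] {f : α → Subsp d}

theorem measurable_subsp_of_inner_starProjection
    (hf : ∀ x y, Measurable fun a => inner ℝ x ((f a).starProjection y)) : Measurable f := by
  have hmat : Measurable fun a =>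
      (Matrix.toEuclideanCLM (n := Fin d) (𝕜 := ℝ)).symm (f a).starProjection := by
    refine measurable_pi_lambda _ fun i => measurable_pi_lambda _ fun j => ?_
    convert hf (EuclideanSpace.single i 1) (EuclideanSpace.single j 1) using 2 with a
    obtain ⟨A, hA⟩ := EquivLike.surjective (Matrix.toEuclideanCLM (n := Fin d) (𝕜 := ℝ))
      (f a).starProjection
    rw [← hA, Matrix.inner_toEuclideanCLM]
    simp
  borelize (EuclideanSpace ℝ (Fin d) →L[ℝ] EuclideanSpace ℝ (Fin d))
  have hproj : Measurable fun a => (f a).starProjection := by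
    simpa [Function.comp_def] using continuous_toEuclideanCLM.measurable.comp hmat
  have hcomap := measurable_comap_iff (g := fun V : Subsp d => V.starProjection).2 hproj
  rwa [← borel_comap] at hcomap

theorem measurable_subsp_of_norm_sub_starProjection
    (hf : ∀ x, Measurable fun a => ‖x - (f a).starProjection x‖) : Measurable f := by
  refine measurable_subsp_of_inner_starProjection fun x y => ?_
  simp_rw [inner_starProjection_eq_polarization _ x y, inner_starProjection_self]
  exact ((measurable_const.sub ((hf (x + y)).pow_const 2)).sub
    (measurable_const.sub ((hf (x - y)).pow_const 2))).div_const 4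

theorem range_toEuclideanCLM_comp_starProjection (B : Mat d) (V : Subsp d) :
    (Matrix.toEuclideanCLM (n := Fin d) (𝕜 := ℝ) B ∘L V.starProjection).range = actSubsp B V := by
  refine (LinearMap.range_comp _ _).trans ?_
  rw [Submodule.range_starProjection]
  rfl

theorem norm_sub_starProjection_range {E G : Type*} [NormedAddCommGroup E]
    [InnerProductSpace ℝ E] [TopologicalSpace G] [AddCommGroup G] [Module ℝ G] (T : G →L[ℝ] E)
    [T.range.HasOrthogonalProjection] {s : Set G} (hs : Dense s) (x : E) :
    ‖x - T.range.starProjection x‖ = ⨅ y : s, ‖x - T y‖ := by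
  rw [Submodule.starProjection_minimal, hs.ciInf' (f := fun y => ‖x - T y‖) (by fun_prop)]
  exact (T.toLinearMap.surjective_rangeRestrict.iInf_comp fun z => ‖x - z‖).symm

-- The distance from `x` to `B V` is an infimum over countably many points of `B V`, each of which
-- depends measurably on `B` and `V`; polarization recovers the projection from these distances.
theorem measurable_uncurry_actSubsp : Measurable (Function.uncurry (actSubsp (d := d))) := by
  refine measurable_subsp_of_norm_sub_starProjection fun x => ?_
  obtain ⟨s, hs, hdense⟩ := TopologicalSpace.exists_countable_dense (EuclideanSpace ℝ (Fin d))
  have := hs.to_subtype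
  have hinf : ∀ p : Mat d × Subsp d, ‖x - (actSubsp p.1 p.2).starProjection x‖ =
      ⨅ y : s, ‖x - Matrix.toEuclideanCLM (n := Fin d) (𝕜 := ℝ) p.1 (p.2.starProjection y)‖ := by
    intro p
    simp_rw [← range_toEuclideanCLM_comp_starProjection p.1 p.2]
    exact norm_sub_starProjection_range _ hdense x
  simp_rw [Function.uncurry_def, hinf]
  refine Measurable.iInf fun y => ?_
  have happly : Continuous fun p : Mat d × EuclideanSpace ℝ (Fin d) =>
      Matrix.toEuclideanCLM (n := Fin d) (𝕜 := ℝ) p.1 p.2 :=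
    (continuous_toEuclideanCLM.comp continuous_fst).clm_apply continuous_snd
  exact (measurable_const.sub (happly.measurable.comp (measurable_fst.prodMk
    ((measurable_starProjection_apply y.1).comp measurable_snd)))).norm

theorem measurable_actSubsp (B : Mat d) : Measurable (actSubsp B) :=
  measurable_uncurry_actSubsp.of_uncurry_left

theorem measurable_actPair (F : Subsp d × Subsp d) : Measurable (actPair F) :=
  measurable_uncurry_actSubsp.of_uncurry_right.prodMk
    measurable_uncurry_actSubsp.of_uncurry_right

theorem actSubsp_mul (A B : Mat d) (V : Subsp d) :
    actSubsp (A * B) V = actSubsp A (actSubsp B V) := by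
  simp [actSubsp, ← Submodule.map_comp, Matrix.toEuclideanLin, Matrix.toLpLin_mul_same]

theorem actSubsp_one (V : Subsp d) : actSubsp (1 : Mat d) V = V := by
  simp [actSubsp]

theorem actPair_mul (F : Subsp d × Subsp d) (A B : Mat d) :
    actPair F (A * B) = actPair (actPair F B) A := by
  simp only [actPair, actSubsp_mul]

end Grassmannian

section MiniflagAction

variable {d k : ℕ} {F : Subsp d × Subsp d}

theorem measurable_uncurry_actMiniflag : Measurable (Function.uncurry (actMiniflag k F)) := by
  change Measurable (Function.uncurry actSubsp ∘ Prod.map id Subtype.val)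
  exact measurable_uncurry_actSubsp.comp (measurable_id.prodMap measurable_subtype_coe)

theorem actSubsp_inv_actSubsp {B : Mat d} (hB : IsUnit B) (V : Subsp d) :
    actSubsp B⁻¹ (actSubsp B V) = V := by
  rw [← actSubsp_mul, Matrix.nonsing_inv_mul B ((Matrix.isUnit_iff_isUnit_det B).1 hB),
    actSubsp_one]

theorem le_comap_actMiniflag {B : Mat d} (hB : IsUnit B) :
    (inferInstance : MeasurableSpace (miniflag k F)) ≤
      (inferInstance : MeasurableSpace (Subsp d)).comap (actMiniflag k F B) := by
  rintro _ ⟨S, hS, rfl⟩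
  refine ⟨actSubsp B⁻¹ ⁻¹' S, measurable_actSubsp _ hS, ?_⟩
  ext V
  simp only [Set.mem_preimage, actMiniflag, actSubsp_inv_actSubsp hB]

theorem finrank_actSubsp {B : Mat d} (hB : IsUnit B) (V : Subsp d) :
    Module.finrank ℝ (actSubsp B V) = Module.finrank ℝ V :=
  le_antisymm (Submodule.finrank_map_le _ _) <| calc
    Module.finrank ℝ V = Module.finrank ℝ (actSubsp B⁻¹ (actSubsp B V)) := by
      rw [actSubsp_inv_actSubsp hB]
    _ ≤ Module.finrank ℝ (actSubsp B V) := Submodule.finrank_map_le _ _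

theorem mapsTo_actSubsp_miniflag {g : Mat d} (hg : IsUnit g) (hgF : actPair F g = F) :
    Set.MapsTo (actSubsp g) (miniflag k F) (miniflag k F) := by
  rintro V ⟨hle₁, hle₂, hfinrank⟩
  exact ⟨(congrArg Prod.fst hgF).ge.trans (Submodule.map_mono hle₁),
    (Submodule.map_mono hle₂).trans (congrArg Prod.snd hgF).le,
    (finrank_actSubsp hg V).trans hfinrank⟩

theorem realizesPrecomp_actMiniflag {g : Mat d} (hg : IsUnit g) (hgF : actPair F g = F) :
    RealizesPrecomp (actMiniflag k F) (· * g)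
      ((mapsTo_actSubsp_miniflag (k := k) hg hgF).restrict (actSubsp g) _ _) where
  measurable_param := (continuous_id.matrix_mul continuous_const).measurable
  measurable_map := ((measurable_actSubsp g).comp measurable_subtype_coe).subtype_mk
  apply_param B := funext fun V => actSubsp_mul B g V

theorem iterate_actSubsp (g : Mat d) (n : ℕ) : (actSubsp g)^[n] = actSubsp (g ^ n) := by
  induction n with
  | zero => exact funext fun V => by simp [actSubsp_one]
  | succ n ih =>
    exact funext fun V => by rw [Function.iterate_succ_apply, ih, pow_succ, actSubsp_mul]

end MiniflagAction

section Transvection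

variable {d : ℕ} {u v : EuclideanSpace ℝ (Fin d)}

/-- The matrix of the map `x ↦ x + t ⟪v, x⟫ u`, a transvection when `u` and `v` are orthogonal. -/
def transvection (u v : EuclideanSpace ℝ (Fin d)) (t : ℝ) : Mat d :=
  1 + t • Matrix.vecMulVec u.ofLp v.ofLp

theorem toEuclideanLin_transvection (u v : EuclideanSpace ℝ (Fin d)) (t : ℝ)
    (x : EuclideanSpace ℝ (Fin d)) :
    Matrix.toEuclideanLin (transvection u v t) x = x + (t * inner ℝ v x) • u := by
  ext i
  rw [EuclideanSpace.inner_eq_star_dotProduct, star_trivial, dotProduct_comm]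
  simp [transvection, Matrix.vecMulVec_mulVec]
  ring

theorem transvection_zero (u v : EuclideanSpace ℝ (Fin d)) : transvection u v 0 = 1 := by
  simp [transvection]

theorem transvection_add (huv : inner ℝ u v = 0) (s t : ℝ) :
    transvection u v (s + t) = transvection u v s * transvection u v t := by
  apply Matrix.toEuclideanLin.injective
  ext1 x
  rw [show Matrix.toEuclideanLin (transvection u v s * transvection u v t) x =
    Matrix.toEuclideanLin (transvection u v s) (Matrix.toEuclideanLin (transvection u v t) x) by
      simp]
  simp only [toEuclideanLin_transvection, inner_add_right, inner_smul_right,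
    real_inner_comm u v, huv]
  module

theorem transvection_pow (huv : inner ℝ u v = 0) (t : ℝ) (n : ℕ) :
    transvection u v t ^ n = transvection u v (n * t) := by
  induction n with
  | zero => simp [transvection_zero]
  | succ n ih => rw [pow_succ, ih, ← transvection_add huv, Nat.cast_succ, add_one_mul]

theorem det_transvection (huv : inner ℝ u v = 0) (t : ℝ) : (transvection u v t).det = 1 := by
  rw [EuclideanSpace.inner_eq_star_dotProduct, star_trivial] at huv
  rw [transvection, ← Matrix.smul_vecMulVec, Matrix.vecMulVec_eq Unit,
    Matrix.det_one_add_replicateCol_mul_replicateRow]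
  simp [dotProduct_smul, huv]

theorem isUnit_transvection (huv : inner ℝ u v = 0) (t : ℝ) : IsUnit (transvection u v t) := by
  rw [Matrix.isUnit_iff_isUnit_det, det_transvection huv]
  exact isUnit_one

theorem actSubsp_transvection_of_mem_orthogonal (t : ℝ) {V : Subsp d} (hv : v ∈ Vᗮ) :
    actSubsp (transvection u v t) V = V := by
  have hfix : Set.EqOn (Matrix.toEuclideanLin (transvection u v t)) id V := fun x hx => by
    simp [toEuclideanLin_transvection, Submodule.inner_left_of_mem_orthogonal hx hv]
  exact SetLike.coe_injective (hfix.image_eq.trans (Set.image_id _))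

theorem actSubsp_transvection_of_mem (huv : inner ℝ u v = 0) (t : ℝ) {V : Subsp d} (hu : u ∈ V) :
    actSubsp (transvection u v t) V = V := by
  have hle : ∀ t, actSubsp (transvection u v t) V ≤ V := by
    rintro t _ ⟨y, hy, rfl⟩
    rw [toEuclideanLin_transvection]
    exact V.add_mem hy (V.smul_mem _ hu)
  refine (hle t).antisymm ?_
  calc V = actSubsp (transvection u v t) (actSubsp (transvection u v (-t)) V) := by
        rw [← actSubsp_mul, ← transvection_add huv, add_neg_cancel, transvection_zero, actSubsp_one]
    _ ≤ actSubsp (transvection u v t) V := Submodule.map_mono (hle (-t))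

end Transvection

section MiniflagPingPong

variable {d k : ℕ} {F : Subsp d × Subsp d} {u v : EuclideanSpace ℝ (Fin d)}

/-- An orthonormal frame `u, v` of the orthogonal complement of `F.1` in `F.2`. When this
complement is a plane, the frame identifies the miniflag over `F` with a projective line, with
homogeneous coordinates `[a : b] ↦ F.1 ⊔ ℝ ∙ (a • u + b • v)`. -/
structure IsMiniflagFrame (F : Subsp d × Subsp d) (u v : EuclideanSpace ℝ (Fin d)) : Prop where
  norm_left : ‖u‖ = 1
  norm_right : ‖v‖ = 1
  inner_eq_zero : inner ℝ u v = 0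
  left_mem : u ∈ F.1ᗮ ⊓ F.2
  right_mem : v ∈ F.1ᗮ ⊓ F.2
  le_span : F.1ᗮ ⊓ F.2 ≤ Submodule.span ℝ {u, v}

namespace IsMiniflagFrame

theorem symm (h : IsMiniflagFrame F u v) : IsMiniflagFrame F v u where
  norm_left := h.norm_right
  norm_right := h.norm_left
  inner_eq_zero := by rw [real_inner_comm, h.inner_eq_zero]
  left_mem := h.right_mem
  right_mem := h.left_mem
  le_span := by rw [Set.pair_comm]; exact h.le_span

theorem exists_of_mem_PF (hF : F ∈ PF d k) : ∃ u v, IsMiniflagFrame F u v := by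
  obtain ⟨hle, hfinrank₁, hfinrank₂⟩ := hF
  have hplane : Module.finrank ℝ (F.1ᗮ ⊓ F.2 : Subsp d) = 2 := by
    have := Submodule.finrank_add_inf_finrank_orthogonal hle
    omega
  let b := (stdOrthonormalBasis ℝ (F.1ᗮ ⊓ F.2 : Subsp d)).reindex (finCongr hplane)
  refine ⟨b 0, b 1, b.orthonormal.1 0, b.orthonormal.1 1, b.orthonormal.2 (by decide), (b 0).2,
    (b 1).2, fun x hx => Submodule.mem_span_pair.2 ⟨b.repr ⟨x, hx⟩ 0, b.repr ⟨x, hx⟩ 1, ?_⟩⟩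
  simpa [Fin.sum_univ_two] using congrArg Subtype.val (b.sum_repr ⟨x, hx⟩)

theorem exists_eq_sup_span (h : IsMiniflagFrame F u v) (hk : Module.finrank ℝ F.1 + 1 = k)
    {V : Subsp d} (hV : V ∈ miniflag k F) :
    ∃ a b : ℝ, 0 < a ^ 2 + b ^ 2 ∧ V = F.1 ⊔ ℝ ∙ (a • u + b • v) := by
  obtain ⟨hle₁, hle₂, hfinrank⟩ := hV
  have hline : Module.finrank ℝ (F.1ᗮ ⊓ V : Subsp d) = 1 := by
    have := Submodule.finrank_add_inf_finrank_orthogonal hle₁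
    omega
  obtain ⟨w, hw₀, hw⟩ := finrank_eq_one_iff'.1 hline
  have hspan : (F.1ᗮ ⊓ V : Subsp d) = ℝ ∙ (w : EuclideanSpace ℝ (Fin d)) := by
    refine le_antisymm (fun x hx => ?_) ((Submodule.span_singleton_le_iff_mem _ _).2 w.2)
    obtain ⟨c, hc⟩ := hw ⟨x, hx⟩
    exact Submodule.mem_span_singleton.2 ⟨c, congrArg Subtype.val hc⟩
  obtain ⟨a, b, hab⟩ := Submodule.mem_span_pair.1 (h.le_span ⟨w.2.1, hle₂ w.2.2⟩)
  refine ⟨a, b, ?_, ?_⟩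
  · by_contra! hle
    obtain ⟨rfl, rfl⟩ : a = 0 ∧ b = 0 := by constructor <;> nlinarith [sq_nonneg a, sq_nonneg b]
    exact hw₀ (Subtype.ext (by simpa using hab.symm))
  · rw [hab, ← hspan, Submodule.sup_orthogonal_inf_of_hasOrthogonalProjection hle₁]

theorem starProjection_sup_span_apply (h : IsMiniflagFrame F u v) {a b : ℝ}
    (hab : 0 < a ^ 2 + b ^ 2) :
    (F.1 ⊔ ℝ ∙ (a • u + b • v)).starProjection v = (b / (a ^ 2 + b ^ 2)) • (a • u + b • v) := by
  have hmem : a • u + b • v ∈ F.1ᗮ := Submodule.add_mem _ (Submodule.smul_mem _ _ h.left_mem.1)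
    (Submodule.smul_mem _ _ h.right_mem.1)
  apply Submodule.eq_starProjection_of_mem_orthogonal
  · exact Submodule.smul_mem _ _ (Submodule.mem_sup_right (Submodule.mem_span_singleton_self _))
  · rw [← Submodule.inf_orthogonal]
    refine ⟨Submodule.sub_mem _ h.right_mem.1 (Submodule.smul_mem _ _ hmem),
      Submodule.mem_orthogonal_singleton_iff_inner_right.2 ?_⟩
    simp only [inner_sub_right, inner_add_left, inner_add_right, inner_smul_left,
      inner_smul_right, h.inner_eq_zero, h.symm.inner_eq_zero, real_inner_self_eq_norm_sq,
      h.norm_left, h.norm_right, conj_trivial]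
    field_simp
    ring

theorem actSubsp_transvection (h : IsMiniflagFrame F u v) (t a b : ℝ) :
    actSubsp (transvection u v t) (F.1 ⊔ ℝ ∙ (a • u + b • v)) =
      F.1 ⊔ ℝ ∙ ((a + t * b) • u + b • v) := by
  have hfix := actSubsp_transvection_of_mem_orthogonal (u := u) t h.right_mem.1
  unfold actSubsp at hfix ⊢
  rw [Submodule.map_sup, hfix, Submodule.map_span, Set.image_singleton,
    toEuclideanLin_transvection]
  simp only [inner_add_right, inner_smul_right, h.symm.inner_eq_zero, real_inner_self_eq_norm_sq,
    h.norm_right]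
  congr 3
  module

theorem actPair_transvection (h : IsMiniflagFrame F u v) (t : ℝ) :
    actPair F (transvection u v t) = F :=
  Prod.ext (actSubsp_transvection_of_mem_orthogonal t h.right_mem.1)
    (actSubsp_transvection_of_mem h.inner_eq_zero t h.left_mem.2)

end IsMiniflagFrame

/-- The half-line `x ≥ c` in the affine coordinate `x = ⟪u, P_V v⟫ / ⟪v, P_V v⟫`, where `P_V` is the
orthogonal projection onto `V`; on a miniflag with frame `u, v` this is `x = a / b`. -/
def coordGE (u v : EuclideanSpace ℝ (Fin d)) (c : ℝ) : Set (Subsp d) :=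
  {V | c * inner ℝ v (V.starProjection v) ≤ inner ℝ u (V.starProjection v) ∧
    0 < inner ℝ v (V.starProjection v)}

theorem measurableSet_coordGE (u v : EuclideanSpace ℝ (Fin d)) (c : ℝ) :
    MeasurableSet (coordGE u v c) := by
  have hcoord : ∀ x, Measurable fun V : Subsp d => inner ℝ x (V.starProjection v) := fun x =>
    measurable_const.inner (measurable_starProjection_apply v)
  exact (measurableSet_le ((hcoord v).const_mul c) (hcoord u)).inter
    (measurableSet_lt measurable_const (hcoord v))

namespace IsMiniflagFrame

theorem sup_span_mem_coordGE_iff (h : IsMiniflagFrame F u v) {a b : ℝ} (hab : 0 < a ^ 2 + b ^ 2)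
    (c : ℝ) : F.1 ⊔ ℝ ∙ (a • u + b • v) ∈ coordGE u v c ↔ c * b ^ 2 ≤ a * b ∧ b ≠ 0 := by
  have hvv : inner ℝ v ((F.1 ⊔ ℝ ∙ (a • u + b • v)).starProjection v) =
      b ^ 2 / (a ^ 2 + b ^ 2) := by
    simp only [h.starProjection_sup_span_apply hab, inner_smul_right, inner_add_right,
      h.symm.inner_eq_zero, real_inner_self_eq_norm_sq, h.norm_right]
    ring
  have huv : inner ℝ u ((F.1 ⊔ ℝ ∙ (a • u + b • v)).starProjection v) =
      a * b / (a ^ 2 + b ^ 2) := by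
    simp only [h.starProjection_sup_span_apply hab, inner_smul_right, inner_add_right,
      h.inner_eq_zero, real_inner_self_eq_norm_sq, h.norm_left]
    ring
  simp only [coordGE, Set.mem_ofPred_eq, hvv, huv, ← mul_div_assoc]
  rw [div_le_div_iff_of_pos_right hab, div_pos_iff_of_pos_right hab, sq_pos_iff]

theorem mapsTo_transvection (h : IsMiniflagFrame F u v) (k : ℕ) (t : ℝ) :
    Set.MapsTo (actSubsp (transvection u v t)) (miniflag k F) (miniflag k F) :=
  mapsTo_actSubsp_miniflag (isUnit_transvection h.inner_eq_zero t) (h.actPair_transvection t)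

theorem actSubsp_transvection_mem_coordGE_iff (h : IsMiniflagFrame F u v) {a b : ℝ}
    (hab : 0 < a ^ 2 + b ^ 2) (c : ℝ) :
    actSubsp (transvection u v 1) (F.1 ⊔ ℝ ∙ (a • u + b • v)) ∈ coordGE u v c ↔
      c * b ^ 2 ≤ (a + b) * b ∧ b ≠ 0 := by
  rw [h.actSubsp_transvection, one_mul,
    h.sup_span_mem_coordGE_iff (by nlinarith [sq_nonneg (a + 2 * b), sq_nonneg a])]

theorem actSubsp_transvection_symm_mem_coordGE_iff (h : IsMiniflagFrame F u v) {a b : ℝ}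
    (hab : 0 < a ^ 2 + b ^ 2) (c : ℝ) :
    actSubsp (transvection v u 1) (F.1 ⊔ ℝ ∙ (a • u + b • v)) ∈ coordGE u v c ↔
      c * (b + a) ^ 2 ≤ a * (b + a) ∧ b + a ≠ 0 := by
  rw [add_comm (a • u), h.symm.actSubsp_transvection, one_mul, add_comm _ (a • u),
    h.sup_span_mem_coordGE_iff (by nlinarith [sq_nonneg (2 * a + b), sq_nonneg b])]

/-- In the affine coordinate `x = a / b` of the miniflag, the transvections act as `x ↦ x + 1` and
`x ↦ x / (x + 1)`, and the table `[0, ∞)` splits into the attracting sets `[1, ∞)` and `[0, 1)`. -/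
theorem isPingPong (h : IsMiniflagFrame F u v) (hk : Module.finrank ℝ F.1 + 1 = k) :
    IsPingPong ((h.mapsTo_transvection k 1).restrict (actSubsp (transvection u v 1)) _ _)
      ((h.symm.mapsTo_transvection k 1).restrict (actSubsp (transvection v u 1)) _ _)
      (Subtype.val ⁻¹' coordGE u v 0) (Subtype.val ⁻¹' coordGE u v 1) where
  measurableSet_table := measurable_subtype_coe (measurableSet_coordGE u v 0)
  measurableSet_attracting := measurable_subtype_coe (measurableSet_coordGE u v 1)
  attracting_subset := fun V hV => ⟨by nlinarith [hV.1, hV.2], hV.2⟩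
  mapsTo_left := by
    rintro ⟨V, hV⟩ hVP
    obtain ⟨a, b, hab, rfl⟩ := h.exists_eq_sup_span hk hV
    obtain ⟨hle, hb⟩ := (h.sup_span_mem_coordGE_iff hab 0).1 hVP
    exact (h.actSubsp_transvection_mem_coordGE_iff hab 1).2 ⟨by linarith, hb⟩
  mapsTo_right := by
    rintro ⟨V, hV⟩ hVP
    obtain ⟨a, b, hab, rfl⟩ := h.exists_eq_sup_span hk hV
    obtain ⟨hle, hb⟩ := (h.sup_span_mem_coordGE_iff hab 0).1 hVP
    have hpos : 0 < b * (b + a) := by nlinarith [sq_pos_of_ne_zero hb]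
    refine ⟨(h.actSubsp_transvection_symm_mem_coordGE_iff hab 0).2
      ⟨by nlinarith [sq_nonneg a], right_ne_zero_of_mul hpos.ne'⟩, fun hQ => ?_⟩
    linarith [((h.actSubsp_transvection_symm_mem_coordGE_iff hab 1).1 hQ).1]
  left_mem_or_right_mem := by
    rintro ⟨V, hV⟩ hVP
    obtain ⟨a, b, hab, rfl⟩ := h.exists_eq_sup_span hk hV
    simp only [Set.mem_preimage, Set.MapsTo.val_restrict_apply, h.sup_span_mem_coordGE_iff hab,
      h.actSubsp_transvection_mem_coordGE_iff hab,
      h.actSubsp_transvection_symm_mem_coordGE_iff hab, zero_mul] at hVP ⊢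
    obtain rfl | hb := eq_or_ne b 0
    · have ha : a ≠ 0 := fun ha => by simp [ha] at hab
      exact .inr ⟨by nlinarith [sq_nonneg a], by simpa using ha⟩
    · by_contra! hout
      have hab_neg : a * b < 0 := not_le.1 fun hle => hVP ⟨hle, hb⟩
      have hleft : (a + b) * b < 0 := not_le.1 fun hle => hb (hout.1 hle)
      have hright : 0 ≤ a * (b + a) :=
        nonneg_of_mul_nonneg_left (by nlinarith [mul_pos_of_neg_of_neg hab_neg hleft])
          (sq_pos_of_ne_zero hb)
      rw [add_comm, hout.2 hright, zero_mul] at hleft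
      exact hleft.false

end IsMiniflagFrame

end MiniflagPingPong

section LebesgueMatrix

open scoped Matrix.Norms.L2Operator

variable {d : ℕ}

instance : (matLebesgue d).IsAddHaarMeasure := by
  rw [show matLebesgue d = (volume : Measure (Fin d → Fin d → ℝ)) from Measure.map_id]
  exact Measure.pi.isAddHaarMeasure fun _ : Fin d => (volume : Measure (Fin d → ℝ))

theorem measurePreserving_mul_right {g : Mat d} (hg : g.det = 1) :
    MeasurePreserving (· * g) (matLebesgue d) (matLebesgue d) := by
  have hrow : MeasurePreserving (Matrix.toLin' g.transpose) := by
    refine ⟨(LinearMap.continuous_of_finiteDimensional _).measurable, ?_⟩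
    simp [Measure.map_linearMap_addHaar_eq_smul_addHaar, hg]
  convert! volume_preserving_pi fun _ : Fin d => hrow using 1
  · ext E i j
    simp [Matrix.mul_apply, Matrix.mulVec, dotProduct, mul_comm]
  all_goals exact Measure.map_id

theorem measurableSet_isUnit : MeasurableSet {B : Mat d | IsUnit B} := by
  have hdet : Continuous fun B : Mat d => B.det := continuous_id.matrix_det
  simp_rw [Matrix.isUnit_iff_isUnit_det, isUnit_iff_ne_zero]
  exact hdet.measurable (measurableSet_singleton 0).compl

theorem ae_isUnit_add_smul_one (B : Mat d) : ∀ᵐ t : ℝ, IsUnit (B + t • (1 : Mat d)) := by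
  filter_upwards [(Matrix.finite_spectrum (-B)).countable.ae_notMem volume] with t ht
  rwa [spectrum.notMem_iff, sub_neg_eq_add, Algebra.algebraMap_eq_smul_one, add_comm] at ht

theorem ae_isUnit_matLebesgue : ∀ᵐ B ∂matLebesgue d, IsUnit B :=
  ae_mem_of_ae_add_linearMap_mem (LinearMap.toSpanSingleton ℝ (Mat d) 1) volume _
    measurableSet_isUnit ae_isUnit_add_smul_one

theorem ae_isUnit_add_smul (A : Mat d) {ε : ℝ} (hε : ε ≠ 0) :
    ∀ᵐ E ∂matLebesgue d, IsUnit (A + ε • E) := by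
  filter_upwards [(measurePreserving_add_left (matLebesgue d)
    (ε⁻¹ • A)).quasiMeasurePreserving.ae ae_isUnit_matLebesgue] with E hE
  rw [show A + ε • E = ε • (ε⁻¹ • A + E) by rw [smul_add, smul_inv_smul₀ hε]]
  exact (isUnit_smul_iff (Units.mk0 ε hε) _).2 hE

end LebesgueMatrix

section UniformEntropy

variable {d k : ℕ} {F : Subsp d × Subsp d} {u v : EuclideanSpace ℝ (Fin d)}

theorem IsMiniflagFrame.iterate_restrict_transvection_inv (h : IsMiniflagFrame F u v) (k : ℕ)
    {n : ℕ} (hn : n ≠ 0) :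
    ((h.mapsTo_transvection k (n : ℝ)⁻¹).restrict (actSubsp (transvection u v (n : ℝ)⁻¹)) _ _)^[n] =
      (h.mapsTo_transvection k 1).restrict (actSubsp (transvection u v 1)) _ _ := by
  rw [Set.MapsTo.iterate_restrict]
  congr! 1
  rw [iterate_actSubsp, transvection_pow h.inner_eq_zero, mul_inv_cancel₀ (Nat.cast_ne_zero.2 hn)]

theorem IsMiniflagFrame.measure_div_le_fiberAveragedEntropy (h : IsMiniflagFrame F u v)
    (hk : Module.finrank ℝ F.1 + 1 = k) {μ : Measure (Mat d)} [IsFiniteMeasure μ]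
    (hμ : ∀ᵐ B ∂μ, IsUnit B) {R : Set (Mat d)} (hR : MeasurableSet R) {K : ℝ≥0} {n : ℕ}
    (hn : n ≠ 0) (hu : (μ.restrict R).map (· * transvection u v (n : ℝ)⁻¹) ≤ K • μ)
    (hv : (μ.restrict R).map (· * transvection v u (n : ℝ)⁻¹) ≤ K • μ) :
    μ R / (128 * (1 + K) * n ^ 2) ≤ fiberAveragedEntropy k μ F := by
  refine measure_div_le_lintegral_pushforwardEntropy_condDistrib (measurable_actPair F)
    measurable_uncurry_actMiniflag measurableSet_isUnit hμ (fun B hB => le_comap_actMiniflag hB)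
    (realizesPrecomp_actMiniflag (isUnit_transvection h.inner_eq_zero _)
      (h.actPair_transvection _))
    (realizesPrecomp_actMiniflag (isUnit_transvection h.symm.inner_eq_zero _)
      (h.symm.actPair_transvection _))
    (fun B => by rw [actPair_mul, h.actPair_transvection])
    (fun B => by rw [actPair_mul, h.symm.actPair_transvection]) hR hu hv ?_
    (P := Subtype.val ⁻¹' coordGE u v 0) (Q := Subtype.val ⁻¹' coordGE u v 1)
  rw [h.iterate_restrict_transvection_inv k hn, h.symm.iterate_restrict_transvection_inv k hn]
  exact h.isPingPong hk

theorem measure_div_le_uniformFiberwiseEntropy {μ : Measure (Mat d)} [IsFiniteMeasure μ]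
    (hμ : ∀ᵐ B ∂μ, IsUnit B) {R : Set (Mat d)} (hR : MeasurableSet R) {K : ℝ≥0} {n : ℕ}
    (hn : n ≠ 0) (h : ∀ u v : EuclideanSpace ℝ (Fin d), ‖u‖ = 1 → ‖v‖ = 1 → inner ℝ u v = 0 →
      (μ.restrict R).map (· * transvection u v (n : ℝ)⁻¹) ≤ K • μ) (k : ℕ) :
    μ R / (128 * (1 + K) * n ^ 2) ≤ uniformFiberwiseEntropy k μ := by
  refine le_iInf₂ fun F hF => ?_
  obtain ⟨u, v, huv⟩ := IsMiniflagFrame.exists_of_mem_PF hF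
  exact huv.measure_div_le_fiberAveragedEntropy hF.2.1 hμ hR hn
    (h u v huv.norm_left huv.norm_right huv.inner_eq_zero)
    (h v u huv.norm_right huv.norm_left huv.symm.inner_eq_zero)

end UniformEntropy

section Perturbation

open scoped Matrix.Norms.L2Operator

theorem map_restrict_withDensity_le {Ω : Type*} [MeasurableSpace Ω] {L : Measure Ω} [SFinite L]
    {f : Ω → ℝ≥0∞} {ψ : Ω → Ω} (hψ : MeasurePreserving ψ L L) {W₀ W : Set Ω}
    (hW₀ : MeasurableSet W₀) (hW : MeasurableSet W) (hmaps : Set.MapsTo ψ W₀ W)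
    {c K : ℝ≥0∞} (hle : ∀ x ∈ W₀, f x ≤ K * c) (hge : ∀ x ∈ W, c ≤ f x) :
    ((L.withDensity f).restrict W₀).map ψ ≤ K • L.withDensity f := by
  refine Measure.le_iff.2 fun S hS => ?_
  rw [Measure.map_apply hψ.measurable hS, Measure.restrict_apply (hψ.measurable hS),
    withDensity_apply' _ _, Measure.smul_apply, withDensity_apply' _ _, smul_eq_mul]
  calc ∫⁻ x in ψ ⁻¹' S ∩ W₀, f x ∂L ≤ ∫⁻ _ in ψ ⁻¹' S ∩ W₀, K * c ∂L :=
        setLIntegral_mono' ((hψ.measurable hS).inter hW₀) fun x hx => hle x hx.2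
    _ = K * c * L (ψ ⁻¹' S ∩ W₀) := setLIntegral_const _ _
    _ ≤ K * c * L (ψ ⁻¹' (S ∩ W)) := by
        gcongr
        exact fun x hx => ⟨hx.1, hmaps hx.2⟩
    _ = K * ∫⁻ _ in S ∩ W, c ∂L := by
        rw [hψ.measure_preimage (hS.inter hW).nullMeasurableSet, setLIntegral_const, mul_assoc]
    _ ≤ K * ∫⁻ x in S ∩ W, f x ∂L := by
        gcongr K * ?_
        exact setLIntegral_mono' (hS.inter hW) fun x hx => hge x hx.2
    _ ≤ K * ∫⁻ x in S, f x ∂L := by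
        gcongr
        exact Set.inter_subset_left

theorem map_restrict_le_of_semiconj {Ω Ω' : Type*} [MeasurableSpace Ω] [MeasurableSpace Ω']
    {η : Measure Ω} {τ : Ω → Ω'} {ψ : Ω → Ω} {θ : Ω' → Ω'} (hτ : Measurable τ)
    (hψ : Measurable ψ) (hθ : Measurable θ) (h : Function.Semiconj τ ψ θ) {R : Set Ω'}
    (hR : MeasurableSet R) {K : ℝ≥0} (hle : (η.restrict (τ ⁻¹' R)).map ψ ≤ K • η) :
    ((η.map τ).restrict R).map θ ≤ K • η.map τ := by
  rw [Measure.restrict_map hτ hR, Measure.map_map hθ hτ, ← h.comp_eq, ← Measure.map_map hτ hψ,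
    ← Measure.map_smul]
  exact Measure.map_mono hle hτ

variable {d : ℕ}

theorem norm_transvection_sub_one_le {u v : EuclideanSpace ℝ (Fin d)} (hu : ‖u‖ = 1)
    (hv : ‖v‖ = 1) (t : ℝ) : ‖transvection u v t - 1‖ ≤ |t| := by
  refine ContinuousLinearMap.opNorm_le_bound _ (abs_nonneg t) fun x => ?_
  calc ‖Matrix.toEuclideanLin (transvection u v t - 1) x‖ = ‖(t * inner ℝ v x) • u‖ := by
        rw [map_sub, LinearMap.sub_apply, toEuclideanLin_transvection, Matrix.toLpLin_one,
          LinearMap.id_apply, add_sub_cancel_left]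
    _ = |t| * |inner ℝ v x| := by rw [norm_smul, hu, mul_one, norm_mul]; rfl
    _ ≤ |t| * ‖x‖ := by
        gcongr
        simpa [hv] using abs_real_inner_le_norm v x

/-- The noise for which the perturbation of `A` of size `ε` is `(A + ε • E) * g`. -/
def mulRightNoise (A : Mat d) (ε : ℝ) (g E : Mat d) : Mat d :=
  E * g + ε⁻¹ • (A * g - A)

theorem semiconj_mulRightNoise (A : Mat d) {ε : ℝ} (hε : ε ≠ 0) (g : Mat d) :
    Function.Semiconj (fun E => A + ε • E) (mulRightNoise A ε g) (· * g) := fun E => by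
  simp only [mulRightNoise, smul_add, smul_inv_smul₀ hε, add_mul, smul_mul_assoc]
  abel

theorem measurePreserving_mulRightNoise (A : Mat d) (ε : ℝ) {g : Mat d} (hg : g.det = 1) :
    MeasurePreserving (mulRightNoise A ε g) (matLebesgue d) (matLebesgue d) :=
  (measurePreserving_add_right _ _).comp (measurePreserving_mul_right hg)

theorem norm_mulRightNoise_sub_le (A : Mat d) {ε : ℝ} (hε : 0 < ε) (g E : Mat d) :
    ‖mulRightNoise A ε g E - E‖ ≤ (‖E‖ + ‖A‖ / ε) * ‖g - 1‖ := by
  calc ‖mulRightNoise A ε g E - E‖ = ‖(E + ε⁻¹ • A) * (g - 1)‖ := by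
        congr 1
        rw [mulRightNoise, mul_sub, add_mul, smul_mul_assoc, mul_one, smul_sub]
        abel
    _ ≤ ‖E + ε⁻¹ • A‖ * ‖g - 1‖ := norm_mul_le _ _
    _ ≤ (‖E‖ + ‖A‖ / ε) * ‖g - 1‖ := by
        gcongr
        refine (norm_add_le _ _).trans_eq ?_
        rw [norm_smul, norm_inv, Real.norm_of_nonneg hε.le, div_eq_inv_mul]

theorem mapsTo_mulRightNoise_ball {A : Mat d} {ε : ℝ} (hε : 0 < ε) {g E₀ : Mat d} {r : ℝ}
    (hr : 0 < r) (hg : (‖E₀‖ + r + ‖A‖ / ε) * ‖g - 1‖ ≤ r / 2) :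
    Set.MapsTo (mulRightNoise A ε g) (Metric.ball E₀ (r / 2)) (Metric.ball E₀ r) := by
  intro E hE
  rw [mem_ball_iff_norm] at hE ⊢
  have hnorm : ‖E‖ ≤ ‖E₀‖ + r := by linarith [norm_le_norm_add_norm_sub' E E₀]
  calc ‖mulRightNoise A ε g E - E₀‖ ≤ ‖mulRightNoise A ε g E - E‖ + ‖E - E₀‖ :=
        norm_sub_le_norm_sub_add_norm_sub _ _ _
    _ ≤ (‖E₀‖ + r + ‖A‖ / ε) * ‖g - 1‖ + ‖E - E₀‖ := by
        grw [norm_mulRightNoise_sub_le A hε g E, hnorm]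
    _ < r := by linarith

theorem preimage_add_smul_ball (A E₀ : Mat d) {ε : ℝ} (hε : 0 < ε) (r : ℝ) :
    (fun E => A + ε • E) ⁻¹' Metric.ball (A + ε • E₀) (ε * r) = Metric.ball E₀ r := by
  ext E
  simp only [Set.mem_preimage, mem_ball_iff_norm, add_sub_add_left_eq_sub, ← smul_sub, norm_smul,
    Real.norm_of_nonneg hε.le, mul_lt_mul_iff_right₀ hε]

theorem map_restrict_perturbation_mul_right_le {f : Mat d → ℝ≥0∞} {E₀ : Mat d} {r : ℝ}
    (hr : 0 < r) {c K : ℝ≥0} (hf : ∀ E ∈ Metric.ball E₀ r, f E ∈ Set.Icc (c : ℝ≥0∞) (K * c))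
    {A : Mat d} {ε : ℝ} (hε : 0 < ε) {g : Mat d} (hdet : g.det = 1)
    (hg : (‖E₀‖ + r + ‖A‖ / ε) * ‖g - 1‖ ≤ r / 2) :
    ((((matLebesgue d).withDensity f).map fun E => A + ε • E).restrict
      (Metric.ball (A + ε • E₀) (ε * (r / 2)))).map (· * g) ≤
        K • ((matLebesgue d).withDensity f).map fun E => A + ε • E := by
  have hψ := measurePreserving_mulRightNoise A ε hdet
  refine map_restrict_le_of_semiconj (by fun_prop) hψ.measurable
    (continuous_id.matrix_mul continuous_const).measurable (semiconj_mulRightNoise A hε.ne' g)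
    measurableSet_ball ?_
  rw [preimage_add_smul_ball A E₀ hε]
  exact map_restrict_withDensity_le hψ measurableSet_ball measurableSet_ball
    (mapsTo_mulRightNoise_ball hε hr hg)
    (fun E hE => (hf E (Metric.ball_subset_ball (by linarith) hE)).2) fun E hE => (hf E hE).1

theorem measure_ball_div_le_uniformFiberwiseEntropy_perturbation {f : Mat d → ℝ≥0∞}
    [IsFiniteMeasure ((matLebesgue d).withDensity f)] {E₀ : Mat d} {r : ℝ} (hr : 0 < r)
    {c K : ℝ≥0} (hf : ∀ E ∈ Metric.ball E₀ r, f E ∈ Set.Icc (c : ℝ≥0∞) (K * c)) {A : Mat d}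
    {ε : ℝ} (hε : 0 < ε)
    (hunit : ∀ᵐ B ∂((matLebesgue d).withDensity f).map fun E => A + ε • E, IsUnit B) {n : ℕ}
    (hn₀ : n ≠ 0) (hn : ‖E₀‖ + r + ‖A‖ / ε ≤ n * (r / 2)) (k : ℕ) :
    (matLebesgue d).withDensity f (Metric.ball E₀ (r / 2)) / (128 * (1 + K) * n ^ 2) ≤
      uniformFiberwiseEntropy k (((matLebesgue d).withDensity f).map fun E => A + ε • E) := by
  have hτ : Measurable fun E => A + ε • E := by fun_prop
  rw [← preimage_add_smul_ball A E₀ hε, ← Measure.map_apply hτ measurableSet_ball]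
  refine measure_div_le_uniformFiberwiseEntropy hunit measurableSet_ball hn₀
    (fun u v hu hv huv => ?_) k
  refine map_restrict_perturbation_mul_right_le hr hf hε (det_transvection huv _) ?_
  have hnpos : (0 : ℝ) < n := by positivity
  calc (‖E₀‖ + r + ‖A‖ / ε) * ‖transvection u v (n : ℝ)⁻¹ - 1‖
      ≤ n * (r / 2) * |(n : ℝ)⁻¹| := by grw [hn, norm_transvection_sub_one_le hu hv]
    _ = r / 2 := by rw [abs_of_pos (inv_pos.2 hnpos)]; field_simp

theorem exists_nat_ge_le_two_mul {x : ℝ} (hx : 1 ≤ x) :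
    ∃ n : ℕ, n ≠ 0 ∧ x ≤ n ∧ (n : ℝ) ≤ 2 * x :=
  ⟨⌈x⌉₊, (Nat.ceil_pos.2 (by linarith)).ne', Nat.le_ceil x,
    by linarith [Nat.ceil_lt_add_one (zero_le_one.trans hx)]⟩

theorem ofReal_le_uniformFiberwiseEntropy_perturbation {f : Mat d → ℝ≥0∞}
    [IsFiniteMeasure ((matLebesgue d).withDensity f)] {E₀ : Mat d} {r : ℝ} (hr : 0 < r)
    {c K : ℝ≥0} (hf : ∀ E ∈ Metric.ball E₀ r, f E ∈ Set.Icc (c : ℝ≥0∞) (K * c)) {A : Mat d}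
    {M ε : ℝ} (hA : ‖A‖ ≤ M) (hε : 0 < ε) (hεM : ε ≤ M)
    (hunit : ∀ᵐ B ∂((matLebesgue d).withDensity f).map fun E => A + ε • E, IsUnit B) (k : ℕ) :
    ENNReal.ofReal (((matLebesgue d).withDensity f).real (Metric.ball E₀ (r / 2)) * r ^ 2 /
        (2048 * (1 + K) * (‖E₀‖ + r + 1) ^ 2) * ε ^ 2 / M ^ 2) ≤
      uniformFiberwiseEntropy k (((matLebesgue d).withDensity f).map fun E => A + ε • E) := by
  have hM : 0 < M := hε.trans_le hεM
  have hMε : 1 ≤ M / ε := (one_le_div hε).2 hεM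
  set L := 2 * (‖E₀‖ + r + 1) / r with hL
  have hL₁ : 1 ≤ L := (one_le_div hr).2 (by linarith [norm_nonneg E₀])
  obtain ⟨n, hn₀, hle_n, hn_le⟩ := exists_nat_ge_le_two_mul (one_le_mul_of_one_le_of_one_le hL₁ hMε)
  have hn : ‖E₀‖ + r + ‖A‖ / ε ≤ n * (r / 2) := calc
    ‖E₀‖ + r + ‖A‖ / ε ≤ (‖E₀‖ + r) * (M / ε) + M / ε := by
      grw [hA, ← le_mul_of_one_le_right (by positivity : 0 ≤ ‖E₀‖ + r) hMε]
    _ = L * (M / ε) * (r / 2) := by rw [hL]; field_simp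
    _ ≤ n * (r / 2) := by gcongr
  refine le_trans (ENNReal.ofReal_le_of_le_toReal ?_)
    (measure_ball_div_le_uniformFiberwiseEntropy_perturbation hr hf hε hunit hn₀ hn k)
  calc _ = ((matLebesgue d).withDensity f).real (Metric.ball E₀ (r / 2)) /
        (128 * (1 + K) * (2 * (L * (M / ε))) ^ 2) := by rw [hL]; field_simp; ring
    _ ≤ ((matLebesgue d).withDensity f).real (Metric.ball E₀ (r / 2)) /
        (128 * (1 + K) * n ^ 2) := by gcongr
    _ = _ := by simp [measureReal_def, ENNReal.toReal_add]

theorem measure_pos_of_eventually_le_density {f : Mat d → ℝ≥0∞} {E₀ : Mat d} {c : ℝ≥0∞}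
    (hc : c ≠ 0) (hf : ∀ᶠ E in nhds E₀, c ≤ f E) {U : Set (Mat d)} (hU : U ∈ nhds E₀) :
    0 < (matLebesgue d).withDensity f U := by
  obtain ⟨V, hVU, hV, hE₀⟩ := mem_nhds_iff.1 (Filter.inter_mem hU hf)
  calc 0 < c * matLebesgue d V := ENNReal.mul_pos hc (hV.measure_pos _ ⟨E₀, hE₀⟩).ne'
    _ = ∫⁻ _ in V, c ∂matLebesgue d := (setLIntegral_const _ _).symm
    _ ≤ ∫⁻ E in V, f E ∂matLebesgue d :=
        setLIntegral_mono' hV.measurableSet fun E hE => (hVU hE).2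
    _ = (matLebesgue d).withDensity f V := (withDensity_apply _ hV.measurableSet).symm
    _ ≤ (matLebesgue d).withDensity f U := measure_mono fun E hE => (hVU hE).1

theorem ae_isUnit_perturbation {η : Measure (Mat d)} (hη : η ≪ matLebesgue d) (A : Mat d) {ε : ℝ}
    (hε : ε ≠ 0) : ∀ᵐ B ∂η.map fun E => A + ε • E, IsUnit B := by
  have hτ : Measurable fun E => A + ε • E := by fun_prop
  exact (ae_map_iff hτ.aemeasurable measurableSet_isUnit).2 (hη.ae_le (ae_isUnit_add_smul A hε))

theorem exists_eventually_density_mem_Icc {X : Type*} [TopologicalSpace X] [MeasurableSpace X]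
    {g : X → ℝ≥0} (hg : Continuous g) {μ : Measure X} (h : μ.withDensity (fun x => g x) ≠ 0) :
    ∃ x₀, ∃ c C : ℝ≥0, c ≠ 0 ∧ ∀ᶠ x in nhds x₀, (g x : ℝ≥0∞) ∈ Set.Icc (c : ℝ≥0∞) C := by
  obtain ⟨x₀, hx₀⟩ : ∃ x, 0 < g x := by
    by_contra! hle
    refine h ?_
    simp only [nonpos_iff_eq_zero.1 (hle _), ENNReal.coe_zero, withDensity_const, zero_smul]
  refine ⟨x₀, g x₀ / 2, 2 * g x₀, (half_pos hx₀).ne', ?_⟩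
  filter_upwards [hg.tendsto x₀ (Icc_mem_nhds (half_lt_self hx₀) (lt_two_mul_self hx₀))] with x hx
  exact ⟨ENNReal.coe_le_coe.2 hx.1, ENNReal.coe_le_coe.2 hx.2⟩

theorem mainTheorem3_general {f : Mat d → ℝ≥0∞} {E₀ : Mat d} {c C : ℝ≥0} (hc : c ≠ 0)
    (hf : ∀ᶠ E in nhds E₀, f E ∈ Set.Icc (c : ℝ≥0∞) C) (η : Measure (Mat d)) [IsFiniteMeasure η]
    (hη : η = (matLebesgue d).withDensity f) :
    ∃ Cf : ℝ, 0 < Cf ∧ ∀ M ε : ℝ, 0 < ε → ε ≤ M → ∀ A : Mat d, opNorm A ≤ M → ∀ k : ℕ,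
      (∀ᵐ B ∂(η.map fun E => A + ε • E), IsUnit B) ∧
      ENNReal.ofReal (Cf * ε ^ 2 / M ^ 2) ≤
        uniformFiberwiseEntropy k (η.map fun E => A + ε • E) := by
  obtain ⟨r, hr, hball⟩ := Metric.eventually_nhds_iff_ball.1 hf
  have hball' : ∀ E ∈ Metric.ball E₀ r, f E ∈ Set.Icc (c : ℝ≥0∞) (↑(C / c) * c) := by
    rwa [← ENNReal.coe_mul, div_mul_cancel₀ C hc]
  subst hη
  have hmass : 0 < ((matLebesgue d).withDensity f).real (Metric.ball E₀ (r / 2)) :=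
    ENNReal.toReal_pos (measure_pos_of_eventually_le_density (ENNReal.coe_ne_zero.2 hc)
      (hf.mono fun E hE => hE.1) (Metric.ball_mem_nhds E₀ (half_pos hr))).ne' (measure_ne_top _ _)
  refine ⟨((matLebesgue d).withDensity f).real (Metric.ball E₀ (r / 2)) * r ^ 2 /
    (2048 * (1 + (C / c : ℝ≥0)) * (‖E₀‖ + r + 1) ^ 2), by positivity,
    fun M ε hε hεM A hA k => ?_⟩
  have hunit := ae_isUnit_perturbation (withDensity_absolutelyContinuous (matLebesgue d) f) A hε.ne'
  exact ⟨hunit, ofReal_le_uniformFiberwiseEntropy_perturbation hr hball' hA hε hεM hunit k⟩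

end Perturbation

end

theorem mainTheorem3 {d : ℕ} (φ : Mat d → ℝ) (hφ_cont : Continuous φ) (hφ_nonneg : ∀ A, 0 ≤ φ A)
    (hφ_decay : ∃ C : ℝ, 0 < C ∧ ∀ A : Mat d, A ≠ 0 → φ A ≤ C / opNorm A ^ (d ^ 2 + 1))
    (η : Measure (Mat d)) [IsProbabilityMeasure η]
    (hη : η = (matLebesgue d).withDensity fun A => ENNReal.ofReal (φ A)) :
    ∃ Cφ : ℝ, 0 < Cφ ∧
      ∀ M : ℝ, 1 ≤ M → ∀ ε : ℝ, 0 < ε → ε ≤ 1 → ∀ A : Mat d, opNorm A ≤ M →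
        ∀ k : ℕ, 1 ≤ k → k < d →
          (∀ᵐ B ∂(η.map fun E => A + ε • E), IsUnit B) ∧
          ENNReal.ofReal (Cφ * ε ^ 2 / M ^ 2) ≤
            uniformFiberwiseEntropy k (η.map fun E => A + ε • E) := by
  obtain ⟨E₀, c, C, hc, hf⟩ := exists_eventually_density_mem_Icc
    (continuous_real_toNNReal.comp hφ_cont) (hη ▸ IsProbabilityMeasure.ne_zero η)
  obtain ⟨Cφ, hCφ, hbound⟩ := mainTheorem3_general hc hf η hη
  exact ⟨Cφ, hCφ, fun M hM ε hε hε₁ A hA k _ _ => hbound M ε hε (hε₁.trans hM) A hA k⟩
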